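/- Let $\mathcal H$ be a complex Hilbert space, let $A,B$ be compact self-adjoint operators on $\mathcal H$, and let $\rho$ be a state, i.e. a positive trace class operator with $\operatorname{tr}\rho=1$. For $a$ in the spectrum $\sigma(A)$ let $P_A(a)$ be the orthogonal projection onto $\ker(A-a)$, let $\Pi_A(a)(\rho)=P_A(a)\rho P_A(a)$ be the Lüders operation, let $\Lambda_A=\sum_{a\in\sigma(A)}\Pi_A(a)$ be the non-selective measurement channel of $A$, and let $\Lambda_A^\dagger(X)=\sum_{a\in\sigma(A)}P_A(a)XP_A(a)$ (strong operator convergence) be its dual on bounded operators; similarly for $B$. Write $\langle X\rangle_\rho=\operatorname{tr}[\rho X]$, and for $(a,b)\in\sigma(A)\times\sigma(B)$ put $$P_\rho^{A\to B}(a\to b)=\operatorname{tr}[\Pi_A(a)(\rho)P_B(b)],\qquad P_\rho^{B\to A}(b\to a)=\operatorname{tr}[\Pi_B(b)(\rho)P_A(a)].$$ Define the maximum disturbance $$\Delta_A(B;\rho)=\sup_{f\in C_0(\sigma(B))}\frac{\bigl|\langle\Lambda_A^\dagger(f(B))-f(B)\rangle_\rho\bigr|}{\|f(B)\|},$$ where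 $f$ is complex-valued, $f(B)$ is given by the continuous functional calculus and $0/0:=0$; $\Delta_B(A;\rho)$ is defined by exchanging $A$ and $B$. Then $P_\rho^{A\to B}$ and $P_\rho^{B\to A}$ are probability distributions (nonnegative point masses with sum $1$), and, regarding both as measures on $\sigma(A)\times\sigma(B)$, $$\bigl\|P_\rho^{A\to B}-P_\rho^{B\to A}\bigr\|_{\mathrm{TV}}\ \ge\ \max\{\Delta_A(B;\rho),\,\Delta_B(A;\rho)\}.$$ Here $\|\mu\|_{\mathrm{TV}}=|\mu|(\sigma(A)\times\sigma(B))$ is the total variation of the signed measure $\mu$ (without a factor $1/2$). -/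

import Mathlib

open scoped ENNReal ZeroAtInfty InnerProductSpace

noncomputable section

namespace SeqMeas

variable {H : Type*} [NormedAddCommGroup H] [InnerProductSpace ℂ H] [CompleteSpace H]

/-! ### Trace class operators and states -/

/-- An index set for an orthonormal basis of `H`. -/
def basisSet (H : Type*) [NormedAddCommGroup H] [InnerProductSpace ℂ H] [CompleteSpace H] :
    Set H :=
  (exists_hilbertBasis ℂ H).choose

/-- A fixed orthonormal basis of `H`, used to write down the trace. The trace of a trace class
operator and the trace class property do not depend on the basis. -/
def basis (H : Type*) [NormedAddCommGroup H] [InnerProductSpace ℂ H] [CompleteSpace H] :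
    HilbertBasis (basisSet H) ℂ H :=
  (exists_hilbertBasis ℂ H).choose_spec.choose

/-- `T` is trace class: `∑ i, ⟪e i, |T| e i⟫ < ∞`, where `|T| = (T⋆ T)^(1/2)`. -/
def IsTraceClass (T : H →L[ℂ] H) : Prop :=
  Summable fun i => ⟪basis H i, CFC.abs T (basis H i)⟫_ℂ

/-- The trace `tr T = ∑ i, ⟪e i, T e i⟫`, meaningful for trace class `T`. -/
def trace (T : H →L[ℂ] H) : ℂ :=
  ∑' i, ⟪basis H i, T (basis H i)⟫_ℂ

/-- `ρ` is a state: a positive trace class operator of trace one. -/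
structure IsState (ρ : H →L[ℂ] H) : Prop where
  isPositive : ρ.IsPositive
  isTraceClass : IsTraceClass ρ
  trace_eq_one : trace ρ = 1

/-- The expectation value `⟨X⟩_ρ = tr[ρ X]`. -/
def expect (ρ X : H →L[ℂ] H) : ℂ :=
  trace (ρ * X)

/-! ### Observables and their projective measurement -/

/-- A quantum observable: a compact self-adjoint operator. -/
structure Observable (H : Type*) [NormedAddCommGroup H] [InnerProductSpace ℂ H]
    [CompleteSpace H] where
  op : H →L[ℂ] H
  isSelfAdjoint : IsSelfAdjoint op
  isCompact : IsCompactOperator op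

namespace Observable

variable (A B : Observable H)

/-- The spectrum `σ(A)`. -/
abbrev spec : Set ℂ := spectrum ℂ A.op

/-- The eigenspace `ker (A - a)`; it is `0` if `a` is a spectral value but no eigenvalue. -/
def eigenspace (a : A.spec) : Submodule ℂ H :=
  (A.op - (a : ℂ) • (1 : H →L[ℂ] H)).ker

instance (a : A.spec) : CompleteSpace (A.eigenspace a) :=
  ContinuousLinearMap.completeSpace_ker _

/-- The spectral projection `P_A(a)`, the orthogonal projection onto the eigenspace of `a`. -/
def proj (a : A.spec) : H →L[ℂ] H :=
  (A.eigenspace a).starProjection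

/-- The Lüders operation `Π_A(a) : ρ ↦ P_A(a) ρ P_A(a)`. -/
def lueders (a : A.spec) (ρ : H →L[ℂ] H) : H →L[ℂ] H :=
  A.proj a * ρ * A.proj a

lemma orthogonalFamily_eigenspace :
    OrthogonalFamily ℂ (fun a : A.spec => A.eigenspace a)
      (fun a => (A.eigenspace a).subtypeₗᵢ) := by
  have h := (A.isSelfAdjoint.isSymmetric.orthogonalFamily_eigenspaces).comp
    (γ := A.spec) Subtype.coe_injective
  have e : ∀ a : A.spec, A.eigenspace a = Module.End.eigenspace (A.op : H →ₗ[ℂ] H) (a : ℂ) := by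
    intro a
    ext v
    simp [eigenspace, sub_eq_zero]
  intro a b hab u v
  exact h hab ⟨u, e a ▸ u.2⟩ ⟨v, e b ▸ v.2⟩

lemma proj_mem (a : A.spec) (v : H) : A.proj a v ∈ A.eigenspace a :=
  Submodule.starProjection_apply_mem _ _

lemma sum_norm_sq_proj_le (s : Finset A.spec) (v : H) :
    ∑ a ∈ s, ‖A.proj a v‖ ^ 2 ≤ ‖v‖ ^ 2 := by
  have h1 : ‖∑ a ∈ s, A.proj a v‖ ^ 2 = ∑ a ∈ s, ‖A.proj a v‖ ^ 2 := by
    simpa using A.orthogonalFamily_eigenspace.norm_sum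
      (fun a => (⟨A.proj a v, A.proj_mem a v⟩ : A.eigenspace a)) s
  have h2 : ∑ a ∈ s, ‖A.proj a v‖ ^ 2 = RCLike.re ⟪∑ a ∈ s, A.proj a v, v⟫_ℂ := by
    rw [sum_inner, map_sum]
    refine Finset.sum_congr rfl fun a _ => ?_
    exact (Submodule.re_inner_starProjection_eq_normSq (K := A.eigenspace a) v).symm
  have h3 := re_inner_le_norm (𝕜 := ℂ) (∑ a ∈ s, A.proj a v) v
  nlinarith [norm_nonneg v, norm_nonneg (∑ a ∈ s, A.proj a v), sq_nonneg
    (‖∑ a ∈ s, A.proj a v‖ - ‖v‖)]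

lemma norm_proj_comp_le (X : H →L[ℂ] H) (a : A.spec) (v : H) :
    ‖A.proj a (X (A.proj a v))‖ ^ 2 ≤ ‖X‖ ^ 2 * ‖A.proj a v‖ ^ 2 := by
  rw [← mul_pow]
  gcongr
  exact (Submodule.norm_starProjection_apply_le _ _).trans (X.le_opNorm _)

lemma summable_norm_sq (X : H →L[ℂ] H) (v : H) :
    Summable fun a : A.spec => ‖A.proj a (X (A.proj a v))‖ ^ 2 := by
  refine summable_of_sum_le (c := ‖X‖ ^ 2 * ‖v‖ ^ 2) (fun _ => by positivity) fun s => ?_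
  calc _ ≤ ∑ a ∈ s, ‖X‖ ^ 2 * ‖A.proj a v‖ ^ 2 :=
        Finset.sum_le_sum fun a _ => A.norm_proj_comp_le X a v
    _ = ‖X‖ ^ 2 * ∑ a ∈ s, ‖A.proj a v‖ ^ 2 := by rw [Finset.mul_sum]
    _ ≤ _ := by gcongr; exact A.sum_norm_sq_proj_le s v

lemma summable_dual (X : H →L[ℂ] H) (v : H) :
    Summable fun a : A.spec => A.proj a (X (A.proj a v)) := by
  have := (A.orthogonalFamily_eigenspace.summable_iff_norm_sq_summable
    (fun a => (⟨A.proj a (X (A.proj a v)), A.proj_mem a _⟩ : A.eigenspace a))).2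
    (by simpa using A.summable_norm_sq X v)
  simpa using this

lemma norm_tsum_dual_le (X : H →L[ℂ] H) (v : H) :
    ‖∑' a : A.spec, A.proj a (X (A.proj a v))‖ ≤ ‖X‖ * ‖v‖ := by
  refine le_of_tendsto (A.summable_dual X v).hasSum.norm (Filter.Eventually.of_forall fun s => ?_)
  have h1 : ‖∑ a ∈ s, A.proj a (X (A.proj a v))‖ ^ 2
      = ∑ a ∈ s, ‖A.proj a (X (A.proj a v))‖ ^ 2 := by
    simpa using A.orthogonalFamily_eigenspace.norm_sum
      (fun a => (⟨A.proj a (X (A.proj a v)), A.proj_mem a _⟩ : A.eigenspace a)) s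
  refine (pow_le_pow_iff_left₀ (norm_nonneg _) (by positivity) two_ne_zero).1 ?_
  rw [h1, mul_pow]
  calc _ ≤ ∑ a ∈ s, ‖X‖ ^ 2 * ‖A.proj a v‖ ^ 2 :=
        Finset.sum_le_sum fun a _ => A.norm_proj_comp_le X a v
    _ = ‖X‖ ^ 2 * ∑ a ∈ s, ‖A.proj a v‖ ^ 2 := by rw [Finset.mul_sum]
    _ ≤ _ := by gcongr; exact A.sum_norm_sq_proj_le s v

/-- The Heisenberg dual `Λ_A† : X ↦ ∑ a ∈ σ(A), P_A(a) X P_A(a)` on bounded operators of the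
non-selective measurement channel `Λ_A : ρ ↦ ∑ a ∈ σ(A), Π_A(a)(ρ)`. The series for `Λ_A†(X)`
converges (unconditionally) in the strong operator topology. -/
def channelDual (X : H →L[ℂ] H) : H →L[ℂ] H :=
  LinearMap.mkContinuous
    { toFun := fun v => ∑' a : A.spec, A.proj a (X (A.proj a v))
      map_add' := fun v w => by
        simp only [map_add]
        exact (A.summable_dual X v).tsum_add (A.summable_dual X w)
      map_smul' := fun c v => by
        simp only [map_smul, RingHom.id_apply]
        exact (A.summable_dual X v).tsum_const_smul c }
    ‖X‖ (A.norm_tsum_dual_le X)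

/-- The disturbance operator `δ_A(X) = Λ_A†(X) - X`. -/
def disturbance (X : H →L[ℂ] H) : H →L[ℂ] H :=
  A.channelDual X - X

/-- `f(A)`, by the continuous functional calculus. -/
def apply (f : C₀(A.spec, ℂ)) : H →L[ℂ] H :=
  cfcHom (R := ℂ) (a := A.op) A.isSelfAdjoint.isStarNormal f.toContinuousMap

/-- The maximum disturbance `Δ_A(B; ρ)`, the supremum over `f ∈ C₀(σ(B))` of
`|⟨δ_A(f(B))⟩_ρ| / ‖f(B)‖`, in `[0, ∞]` (the quotient `0 / 0` is `0`). -/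
def maxDisturbance (ρ : H →L[ℂ] H) : ℝ≥0∞ :=
  ⨆ f : C₀(B.spec, ℂ), ‖expect ρ (A.disturbance (B.apply f))‖ₑ / ‖B.apply f‖ₑ

/-! ### Joint distributions of sequential measurements -/

/-- The operational joint probability `P_ρ^{A → B}(a → b) = tr[Π_A(a)(ρ) P_B(b)]`; the trace is
a nonnegative real number. -/
def opProb (ρ : H →L[ℂ] H) (p : A.spec × B.spec) : ℝ :=
  (trace (A.lueders p.1 ρ * B.proj p.2)).re

/-- The joint distribution `P_ρ^{A → B}` as a signed measure on `σ(A) × σ(B)`, with point masses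
`P_ρ^{A → B}(a → b)`. -/
def opDist (ρ : H →L[ℂ] H) : MeasureTheory.SignedMeasure (A.spec × B.spec) :=
  MeasureTheory.Measure.count.withDensityᵥ (A.opProb B ρ)

end Observable

end SeqMeas

end

namespace SeqMeas

variable {H : Type*} [NormedAddCommGroup H] [InnerProductSpace ℂ H] [CompleteSpace H]

/-! ### Sums of squares and the trace -/

/-! Both expectations in the disturbance integrate the same function `f(b)` over `σ(A) × σ(B)`. The
spectral projections of a compact self-adjoint operator sum strongly to `1` (`hasSum_proj`), and
`f(B)` acts on the range of `P_B(b)` as `f(b)` (`apply_proj`). Hence `⟨Λ_A†(f(B))⟩_ρ = ∑ f(b) P(a →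
b)` (`hasSum_expect_channelDual_apply`), while inserting `∑ P_A(a) = 1` after a measurement of `B`
gives `⟨f(B)⟩_ρ = ∑ f(b) P(b → a)` (`hasSum_expect_apply`). Their difference is at most `‖f(B)‖ ∑
|P(a → b) - P(b → a)|`, and the total variation dominates this sum of point masses. Convergence is
controlled by `u_j = √ρ e_j` with `∑ ‖u_j‖² = 1`: traces become `∑_j ⟪u_j, X u_j⟫`, joint
probabilities become `∑_j ‖P_B(b) P_A(a) u_j‖²`, and every exchange of sums is Fubini for a bounded
function against summable nonnegative weights. -/

lemma hasSum_norm_inner_sq {E : Type*} [NormedAddCommGroup E] [InnerProductSpace ℂ E]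
    {ι : Type*} (e : HilbertBasis ι ℂ E) (v : E) :
    HasSum (fun i => ‖⟪e i, v⟫_ℂ‖ ^ 2) (‖v‖ ^ 2) := by
  have h := (e.hasSum_inner_mul_inner v v).mapL Complex.reCLM
  convert h using 1
  · ext i
    change _ = RCLike.re (⟪v, e i⟫_ℂ * ⟪e i, v⟫_ℂ)
    rw [inner_mul_symm_re_eq_norm, norm_mul, norm_inner_symm v, sq]
  · exact (inner_self_eq_norm_sq (𝕜 := ℂ) v).symm

/-- The vectors `√ρ e_j`, which decompose the state `ρ`. -/
noncomputable def rootVec (ρ : H →L[ℂ] H) (j : basisSet H) : H :=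
  CFC.sqrt ρ (basis H j)

lemma inner_sqrt_apply (ρ : H →L[ℂ] H) (v w : H) :
    ⟪CFC.sqrt ρ v, w⟫_ℂ = ⟪v, CFC.sqrt ρ w⟫_ℂ := by
  have h : IsSelfAdjoint (CFC.sqrt ρ) := (CFC.sqrt_nonneg ρ).isSelfAdjoint
  exact h.isSymmetric v w

lemma sqrt_sqrt_apply {ρ : H →L[ℂ] H} (hρ : ρ.IsPositive) (v : H) :
    CFC.sqrt ρ (CFC.sqrt ρ v) = ρ v := by
  have h := CFC.sqrt_mul_sqrt_self ρ ((ContinuousLinearMap.nonneg_iff_isPositive ρ).2 hρ)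
  exact congrArg (fun T : H →L[ℂ] H => T v) h

lemma IsState.hasSum_norm_rootVec_sq {ρ : H →L[ℂ] H} (hρ : IsState ρ) :
    HasSum (fun j => ‖rootVec ρ j‖ ^ 2) 1 := by
  have habs : CFC.abs ρ = ρ :=
    CFC.abs_of_nonneg ρ ((ContinuousLinearMap.nonneg_iff_isPositive ρ).2 hρ.isPositive)
  have hs : Summable fun i => ⟪basis H i, ρ (basis H i)⟫_ℂ := by
    have := hρ.isTraceClass
    rwa [IsTraceClass, habs] at this
  have h := hs.hasSum.mapL Complex.reCLM
  have h1 : ∑' i, ⟪basis H i, ρ (basis H i)⟫_ℂ = 1 := hρ.trace_eq_one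
  rw [h1, Complex.reCLM_apply, Complex.one_re] at h
  convert h using 1
  ext j
  rw [← sqrt_sqrt_apply hρ.isPositive, ← inner_sqrt_apply]
  exact (inner_self_eq_norm_sq (𝕜 := ℂ) _).symm

lemma summable_norm_inner_sq {E : Type*} [NormedAddCommGroup E] [InnerProductSpace ℂ E]
    {ι κ : Type*} (e : HilbertBasis ι ℂ E) {u : κ → E}
    (hu : Summable fun j => ‖u j‖ ^ 2) :
    Summable fun p : κ × ι => ‖⟪e p.2, u p.1⟫_ℂ‖ ^ 2 := by
  refine (summable_prod_of_nonneg fun _ => by positivity).2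
    ⟨fun j => (hasSum_norm_inner_sq e (u j)).summable, ?_⟩
  simpa only [(hasSum_norm_inner_sq e _).tsum_eq] using hu

lemma summable_norm_map_sq {E : Type*} [NormedAddCommGroup E] [InnerProductSpace ℂ E]
    {κ : Type*} (X : E →L[ℂ] E) {u : κ → E}
    (hu : Summable fun j => ‖u j‖ ^ 2) : Summable fun j => ‖X (u j)‖ ^ 2 := by
  refine .of_nonneg_of_le (fun _ => by positivity) (fun j => ?_) (hu.mul_left (‖X‖ ^ 2))
  rw [← mul_pow]
  gcongr
  exact X.le_opNorm _

/-- Parseval's identity for square summable families, with the two summations exchanged. -/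
lemma hasSum_tsum_inner_mul_inner {E : Type*} [NormedAddCommGroup E] [InnerProductSpace ℂ E]
    {ι κ : Type*} (e : HilbertBasis ι ℂ E) {u w : κ → E}
    (hu : Summable fun j => ‖u j‖ ^ 2) (hw : Summable fun j => ‖w j‖ ^ 2) :
    HasSum (fun i => ∑' j, ⟪u j, e i⟫_ℂ * ⟪e i, w j⟫_ℂ) (∑' j, ⟪u j, w j⟫_ℂ) ∧
      Summable fun j => ⟪u j, w j⟫_ℂ := by
  have hs : Summable fun p : κ × ι => ⟪u p.1, e p.2⟫_ℂ * ⟪e p.2, w p.1⟫_ℂ := by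
    refine .of_norm_bounded ((summable_norm_inner_sq e hu).add (summable_norm_inner_sq e hw))
      fun p => ?_
    -- The domination `xy ≤ x² + y²` gives absolute convergence of the double series.
    rw [norm_mul, norm_inner_symm (u p.1)]
    nlinarith [sq_nonneg (‖⟪e p.2, u p.1⟫_ℂ‖ - ‖⟪e p.2, w p.1⟫_ℂ‖),
      sq_nonneg ‖⟪e p.2, u p.1⟫_ℂ‖, sq_nonneg ‖⟪e p.2, w p.1⟫_ℂ‖]
  have h1 := hs.hasSum.prod_fiberwise fun j => e.hasSum_inner_mul_inner (u j) (w j)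
  refine ⟨?_, h1.summable⟩
  rw [h1.tsum_eq]
  have h2 := (Equiv.prodComm ι κ).hasSum_iff.2 hs.hasSum
  exact h2.prod_fiberwise fun i => (h2.summable.prod_factor i).hasSum

lemma IsState.summable_inner_map {ρ : H →L[ℂ] H} (hρ : IsState ρ) (X : H →L[ℂ] H) :
    Summable fun j => ⟪rootVec ρ j, X (rootVec ρ j)⟫_ℂ :=
  (hasSum_tsum_inner_mul_inner (basis H) hρ.hasSum_norm_rootVec_sq.summable
    (summable_norm_map_sq X hρ.hasSum_norm_rootVec_sq.summable)).2

/-- Cyclicity of the trace, in terms of the decomposition of `ρ` into the vectors `√ρ e_j`. -/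
lemma IsState.trace_mul_mul {ρ : H →L[ℂ] H} (hρ : IsState ρ) (Y X : H →L[ℂ] H) :
    trace (Y * ρ * X) = ∑' j, ⟪rootVec ρ j, X (Y (rootVec ρ j))⟫_ℂ := by
  have hu := hρ.hasSum_norm_rootVec_sq.summable
  -- The basis is inserted between `X† u_j` and `Y u_j`, and the sum over `j` is moved inside.
  have h := (hasSum_tsum_inner_mul_inner (basis H) (summable_norm_map_sq X.adjoint hu)
    (summable_norm_map_sq Y hu)).1
  simp only [ContinuousLinearMap.adjoint_inner_left] at h
  rw [← h.tsum_eq, trace]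
  congr 1
  ext i
  -- The diagonal entry `⟪e_i, Y ρ X e_i⟫` is `⟪√ρ Y† e_i, √ρ X e_i⟫`; Parseval in `j` expands it
  -- into the inner sum above.
  have h2 := (basis H).hasSum_inner_mul_inner (CFC.sqrt ρ (Y.adjoint (basis H i)))
    (CFC.sqrt ρ (X (basis H i)))
  rw [inner_sqrt_apply, sqrt_sqrt_apply hρ.isPositive, ContinuousLinearMap.adjoint_inner_left] at h2
  change ⟪basis H i, Y (ρ (X (basis H i)))⟫_ℂ = _
  rw [← h2.tsum_eq]
  congr 1
  ext j
  rw [inner_sqrt_apply, ContinuousLinearMap.adjoint_inner_left, ← inner_sqrt_apply, mul_comm]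
  rfl

lemma IsState.expect_eq {ρ : H →L[ℂ] H} (hρ : IsState ρ) (X : H →L[ℂ] H) :
    expect ρ X = ∑' j, ⟪rootVec ρ j, X (rootVec ρ j)⟫_ℂ := by
  simpa [expect] using hρ.trace_mul_mul 1 X

lemma IsState.expect_sub {ρ : H →L[ℂ] H} (hρ : IsState ρ) (X Y : H →L[ℂ] H) :
    expect ρ (X - Y) = expect ρ X - expect ρ Y := by
  simp only [hρ.expect_eq, sub_apply, inner_sub_right]
  exact (hρ.summable_inner_map X).tsum_sub (hρ.summable_inner_map Y)

/-! ### Exchanging sums against nonnegative weights -/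

lemma summable_mul_ofReal {κ : Type*} {c : κ → ℂ} {C : ℝ} (hc : ∀ k, ‖c k‖ ≤ C) {w : κ → ℝ}
    (hw0 : ∀ k, 0 ≤ w k) (hw : Summable w) : Summable fun k => c k * (w k : ℂ) := by
  refine .of_norm_bounded (hw.mul_left C) fun k => ?_
  rw [norm_mul, Complex.norm_real, Real.norm_of_nonneg (hw0 k)]
  exact mul_le_mul_of_nonneg_right (hc k) (hw0 k)

lemma hasSum_prod_of_nonneg {ι κ : Type*} {w : ι × κ → ℝ} {s : ι → ℝ} {t : ℝ}
    (hw0 : ∀ p, 0 ≤ w p) (hs : ∀ j, HasSum (fun k => w (j, k)) (s j)) (ht : HasSum s t) :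
    HasSum w t := by
  have h : Summable w := (summable_prod_of_nonneg hw0).2
    ⟨fun j => (hs j).summable, by simpa only [(hs _).tsum_eq] using ht.summable⟩
  have := h.hasSum.prod_fiberwise hs
  rw [← this.unique ht]
  exact h.hasSum

lemma hasSum_prod_mul_ofReal {ι κ : Type*} {c : ι × κ → ℂ} {C : ℝ} (hc : ∀ p, ‖c p‖ ≤ C)
    {w : ι × κ → ℝ} (hw0 : ∀ p, 0 ≤ w p) (hw : Summable w) {s : ι → ℂ} {t : ℂ}
    (hs : ∀ j, HasSum (fun k => c (j, k) * (w (j, k) : ℂ)) (s j)) (ht : HasSum s t) :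
    HasSum (fun p => c p * (w p : ℂ)) t := by
  have h := summable_mul_ofReal hc hw0 hw
  have := h.hasSum.prod_fiberwise hs
  rw [← this.unique ht]
  exact h.hasSum

/-- Since `c` does not depend on `j`, the weights can be summed over `j` first; here `j` will index
the vectors `√ρ e_j`. -/
lemma hasSum_mul_tsum_ofReal {ι κ : Type*} {c : κ → ℂ} {C : ℝ} (hc : ∀ k, ‖c k‖ ≤ C)
    {w : ι × κ → ℝ} (hw0 : ∀ p, 0 ≤ w p) (hw : Summable w) {s : ι → ℂ} {t : ℂ}
    (hs : ∀ j, HasSum (fun k => c k * (w (j, k) : ℂ)) (s j)) (ht : HasSum s t) :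
    HasSum (fun k => c k * ((∑' j, w (j, k) : ℝ) : ℂ)) t := by
  have h := hasSum_prod_mul_ofReal (c := fun p => c p.2) (fun p => hc p.2) hw0 hw hs ht
  have h2 := (Equiv.prodComm κ ι).hasSum_iff.2 h
  refine h2.prod_fiberwise fun k => ?_
  have h3 : Summable fun j => w (j, k) :=
    ((Equiv.prodComm κ ι).summable_iff.2 hw).prod_factor k
  exact (Complex.hasSum_ofReal.2 h3.hasSum).mul_left (c k)

namespace Observable

variable (A B : Observable H)

/-! ### Completeness of the spectral projections -/

lemma proj_apply_self {a : A.spec} {v : H} (hv : v ∈ A.eigenspace a) : A.proj a v = v :=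
  Submodule.starProjection_eq_self_iff.2 hv

lemma mem_eigenspace {a : A.spec} {v : H} : v ∈ A.eigenspace a ↔ A.op v = (a : ℂ) • v := by
  simp [eigenspace, sub_eq_zero]

lemma inner_proj_self (a : A.spec) (v : H) : ⟪v, A.proj a v⟫_ℂ = ((‖A.proj a v‖ ^ 2 : ℝ) : ℂ) := by
  have h : A.proj a (A.proj a v) = A.proj a v := A.proj_apply_self (A.proj_mem a v)
  conv_lhs => rw [← h]
  rw [proj, ← Submodule.inner_starProjection_left_eq_right, inner_self_eq_norm_sq_to_K]
  norm_cast

lemma inner_proj_left (a : A.spec) (v w : H) : ⟪A.proj a v, w⟫_ℂ = ⟪v, A.proj a w⟫_ℂ :=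
  Submodule.inner_starProjection_left_eq_right _ _ _

lemma proj_proj_of_ne {a b : A.spec} (h : a ≠ b) (v : H) : A.proj a (A.proj b v) = 0 := by
  refine (Submodule.starProjection_apply_eq_zero_iff _).2 ((Submodule.mem_orthogonal _ _).2 ?_)
  intro u hu
  exact A.orthogonalFamily_eigenspace h ⟨u, hu⟩ ⟨A.proj b v, A.proj_mem b v⟩

/-- The remainder `v - ∑ P_A(a) v` is orthogonal to every eigenspace, hence zero by the spectral
theorem for compact self-adjoint operators. -/
lemma hasSum_proj (v : H) : HasSum (fun a => A.proj a v) v := by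
  have hs : Summable fun a => A.proj a v := by
    have := A.summable_dual 1 v
    simpa [A.proj_apply_self (A.proj_mem _ v)] using this
  have hr : v - ∑' a, A.proj a v = 0 := by
    rw [← Submodule.mem_bot ℂ, ← ContinuousLinearMap.orthogonalComplement_iSup_eigenspaces_eq_bot
      A.isCompact A.isSelfAdjoint.isSymmetric, ← Submodule.iInf_orthogonal, Submodule.mem_iInf]
    intro μ
    by_cases hμ : μ ∈ A.spec
    · have e : Module.End.eigenspace (A.op : H →ₗ[ℂ] H) μ = A.eigenspace ⟨μ, hμ⟩ := by
        ext w
        simp [A.mem_eigenspace]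
      rw [e, ← Submodule.starProjection_apply_eq_zero_iff]
      change A.proj ⟨μ, hμ⟩ _ = 0
      rw [map_sub, (A.proj _).map_tsum hs, tsum_eq_single ⟨μ, hμ⟩
        fun b hb => A.proj_proj_of_ne hb.symm v, A.proj_apply_self (A.proj_mem _ v), sub_self]
    -- The spectral theorem ranges over all `μ : ℂ`; off the spectrum `A - μ` is injective, so
    -- nothing is added.
    · have e : Module.End.eigenspace (A.op : H →ₗ[ℂ] H) μ = ⊥ := by
        refine (Submodule.eq_bot_iff _).2 fun w hw => ?_
        have hw' : A.op w = μ • w := by simpa using hw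
        obtain ⟨R, hR⟩ := (spectrum.notMem_iff.1 hμ).exists_left_inv
        have := congrArg (fun T : H →L[ℂ] H => T w) hR
        simpa [hw', Algebra.algebraMap_eq_smul_one] using this.symm
      simp [e]
  have := hs.hasSum
  rwa [← sub_eq_zero.1 hr] at this

lemma hasSum_norm_proj_sq (v : H) : HasSum (fun a => ‖A.proj a v‖ ^ 2) (‖v‖ ^ 2) := by
  have h := ((A.hasSum_proj v).mapL (innerSL ℂ v)).mapL Complex.reCLM
  simpa [inner_proj_self, ← Complex.ofReal_pow] using h

/-! ### The functional calculus -/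

/-- Stone–Weierstrass: the functions `g` for which `g(A)` acts on `w` as `g a` are closed under
limits and the algebra operations, and include the constants, the identity and, as `a` is real, its
conjugate. -/
lemma apply_proj (f : C₀(A.spec, ℂ)) (a : A.spec) (v : H) :
    A.apply f (A.proj a v) = f a • A.proj a v := by
  set w := A.proj a v
  have hw : A.op w = (a : ℂ) • w := A.mem_eigenspace.1 (A.proj_mem a v)
  have key : ∀ g : C(A.spec, ℂ),
      cfcHom (R := ℂ) (a := A.op) A.isSelfAdjoint.isStarNormal g w = g a • w := by
    intro g
    induction g using ContinuousMap.induction_on_of_compact with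
    | const r =>
      have : ContinuousMap.const A.spec r = algebraMap ℂ C(A.spec, ℂ) r := rfl
      rw [this, AlgHomClass.commutes]
      simp [Algebra.algebraMap_eq_smul_one]
    | id =>
      rw [cfcHom_id]
      simpa using hw
    | star_id =>
      rw [map_star, cfcHom_id, A.isSelfAdjoint.star_eq, hw]
      have : star (a : ℂ) = a := by
        simpa using (A.isSelfAdjoint.mem_spectrum_eq_re a.2 ▸ Complex.conj_ofReal _)
      simp [this]
    | add f g hf hg => simp [hf, hg, add_smul]
    | mul f g hf hg =>
      rw [map_mul, mul_apply_eq_comp, hg, map_smul, hf, smul_smul, ContinuousMap.mul_apply,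
        mul_comm]
    | frequently f hf =>
      have hc : IsClosed {g : C(A.spec, ℂ) |
          cfcHom (R := ℂ) (a := A.op) A.isSelfAdjoint.isStarNormal g w = g a • w} := by
        refine isClosed_eq ?_ (by fun_prop)
        exact (ContinuousLinearMap.apply ℂ H w).continuous.comp (cfcHom_continuous _)
      exact hc.mem_of_frequently_of_tendsto hf Filter.tendsto_id
  exact key f.toContinuousMap

/-- The functional calculus is isometric, so the denominator of the disturbance bounds the test
function pointwise. -/
lemma norm_coe_le_norm_apply (f : C₀(A.spec, ℂ)) (a : A.spec) : ‖f a‖ ≤ ‖A.apply f‖ := by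
  rw [apply, norm_cfcHom A.op f.toContinuousMap A.isSelfAdjoint.isStarNormal]
  exact ContinuousMap.norm_coe_le_norm f.toContinuousMap a

lemma hasSum_inner_apply (f : C₀(A.spec, ℂ)) (v : H) :
    HasSum (fun a => f a * ((‖A.proj a v‖ ^ 2 : ℝ) : ℂ)) ⟪v, A.apply f v⟫_ℂ := by
  have h := ((A.hasSum_proj v).mapL (A.apply f)).mapL (innerSL ℂ v)
  simpa only [apply_proj, innerSL_apply_apply, inner_smul_right, inner_proj_self] using h

/-! ### Joint probabilities -/

lemma hasSum_norm_proj_proj_sq (v : H) :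
    HasSum (fun p : A.spec × B.spec => ‖B.proj p.2 (A.proj p.1 v)‖ ^ 2) (‖v‖ ^ 2) := by
  have h0 : ∀ p : A.spec × B.spec, 0 ≤ ‖B.proj p.2 (A.proj p.1 v)‖ ^ 2 := fun p => sq_nonneg _
  have h1 : ∀ a, HasSum (fun b => ‖B.proj b (A.proj a v)‖ ^ 2) (‖A.proj a v‖ ^ 2) :=
    fun a => B.hasSum_norm_proj_sq (A.proj a v)
  exact hasSum_prod_of_nonneg h0 h1 (A.hasSum_norm_proj_sq v)

lemma hasSum_inner_channelDual_apply (f : C₀(B.spec, ℂ)) (v : H) :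
    HasSum (fun p : A.spec × B.spec => f p.2 * ((‖B.proj p.2 (A.proj p.1 v)‖ ^ 2 : ℝ) : ℂ))
      ⟪v, A.channelDual (B.apply f) v⟫_ℂ := by
  have hc : ∀ p : A.spec × B.spec, ‖f p.2‖ ≤ ‖B.apply f‖ :=
    fun p => B.norm_coe_le_norm_apply f p.2
  have h0 : ∀ p : A.spec × B.spec, 0 ≤ ‖B.proj p.2 (A.proj p.1 v)‖ ^ 2 := fun p => sq_nonneg _
  have h1 : ∀ a, HasSum (fun b => f b * ((‖B.proj b (A.proj a v)‖ ^ 2 : ℝ) : ℂ))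
      ⟪A.proj a v, B.apply f (A.proj a v)⟫_ℂ := fun a => B.hasSum_inner_apply f (A.proj a v)
  have h2 : HasSum (fun a => ⟪A.proj a v, B.apply f (A.proj a v)⟫_ℂ)
      ⟪v, A.channelDual (B.apply f) v⟫_ℂ := by
    have h := (A.summable_dual (B.apply f) v).hasSum.mapL (innerSL ℂ v)
    simp only [innerSL_apply_apply, ← inner_proj_left] at h
    exact h
  exact hasSum_prod_mul_ofReal hc h0 (A.hasSum_norm_proj_proj_sq B v).summable h1 h2

/-- For fixed `b`, the sum over `a` collapses to `‖P_B(b) v‖²` by completeness for `A`. -/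
lemma hasSum_inner_apply_swap (f : C₀(B.spec, ℂ)) (v : H) :
    HasSum (fun p : A.spec × B.spec => f p.2 * ((‖A.proj p.1 (B.proj p.2 v)‖ ^ 2 : ℝ) : ℂ))
      ⟪v, B.apply f v⟫_ℂ := by
  have hc : ∀ p : B.spec × A.spec, ‖f p.1‖ ≤ ‖B.apply f‖ :=
    fun p => B.norm_coe_le_norm_apply f p.1
  have h0 : ∀ p : B.spec × A.spec, 0 ≤ ‖A.proj p.2 (B.proj p.1 v)‖ ^ 2 := fun p => sq_nonneg _
  have h1 : ∀ b, HasSum (fun a => f b * ((‖A.proj a (B.proj b v)‖ ^ 2 : ℝ) : ℂ))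
      (f b * ((‖B.proj b v‖ ^ 2 : ℝ) : ℂ)) :=
    fun b => (Complex.hasSum_ofReal.2 (A.hasSum_norm_proj_sq (B.proj b v))).mul_left (f b)
  exact (Equiv.prodComm B.spec A.spec).hasSum_iff.1 (hasSum_prod_mul_ofReal hc h0
    (B.hasSum_norm_proj_proj_sq A v).summable h1 (B.hasSum_inner_apply f v))

variable {ρ : H →L[ℂ] H}

lemma hasSum_prod_norm_proj_proj_rootVec_sq (hρ : IsState ρ) :
    HasSum (fun q : basisSet H × A.spec × B.spec =>
      ‖B.proj q.2.2 (A.proj q.2.1 (rootVec ρ q.1))‖ ^ 2) 1 := by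
  have h0 : ∀ q : basisSet H × A.spec × B.spec,
      0 ≤ ‖B.proj q.2.2 (A.proj q.2.1 (rootVec ρ q.1))‖ ^ 2 := fun q => sq_nonneg _
  have h1 : ∀ j, HasSum (fun p : A.spec × B.spec => ‖B.proj p.2 (A.proj p.1 (rootVec ρ j))‖ ^ 2)
      (‖rootVec ρ j‖ ^ 2) := fun j => A.hasSum_norm_proj_proj_sq B (rootVec ρ j)
  exact hasSum_prod_of_nonneg h0 h1 hρ.hasSum_norm_rootVec_sq

lemma opProb_eq (hρ : IsState ρ) (p : A.spec × B.spec) :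
    A.opProb B ρ p = ∑' j, ‖B.proj p.2 (A.proj p.1 (rootVec ρ j))‖ ^ 2 := by
  have h : ∀ v, ⟪v, (A.proj p.1 * B.proj p.2) (A.proj p.1 v)⟫_ℂ
      = ((‖B.proj p.2 (A.proj p.1 v)‖ ^ 2 : ℝ) : ℂ) := fun v => by
    rw [mul_apply_eq_comp, ← inner_proj_left, inner_proj_self]
  rw [opProb, lueders, mul_assoc, hρ.trace_mul_mul]
  simp only [h, ← Complex.ofReal_tsum, Complex.ofReal_re]

lemma opProb_nonneg (hρ : IsState ρ) (p : A.spec × B.spec) : 0 ≤ A.opProb B ρ p := by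
  rw [A.opProb_eq B hρ]
  exact tsum_nonneg fun _ => by positivity

lemma hasSum_opProb (hρ : IsState ρ) : HasSum (A.opProb B ρ) 1 := by
  have h := (Equiv.prodComm _ _).hasSum_iff.2 (A.hasSum_prod_norm_proj_proj_rootVec_sq B hρ)
  refine h.prod_fiberwise fun p => ?_
  rw [A.opProb_eq B hρ]
  exact (h.summable.prod_factor p).hasSum

lemma hasSum_expect_channelDual_apply (hρ : IsState ρ) (f : C₀(B.spec, ℂ)) :
    HasSum (fun p : A.spec × B.spec => f p.2 * (A.opProb B ρ p : ℂ))
      (expect ρ (A.channelDual (B.apply f))) := by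
  have hc : ∀ p : A.spec × B.spec, ‖f p.2‖ ≤ ‖B.apply f‖ :=
    fun p => B.norm_coe_le_norm_apply f p.2
  have h0 : ∀ q : basisSet H × A.spec × B.spec,
      0 ≤ ‖B.proj q.2.2 (A.proj q.2.1 (rootVec ρ q.1))‖ ^ 2 := fun q => sq_nonneg _
  have h1 : ∀ j, HasSum (fun p : A.spec × B.spec =>
        f p.2 * ((‖B.proj p.2 (A.proj p.1 (rootVec ρ j))‖ ^ 2 : ℝ) : ℂ))
      ⟪rootVec ρ j, A.channelDual (B.apply f) (rootVec ρ j)⟫_ℂ :=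
    fun j => A.hasSum_inner_channelDual_apply B f (rootVec ρ j)
  simp only [A.opProb_eq B hρ, hρ.expect_eq]
  exact hasSum_mul_tsum_ofReal hc h0 (A.hasSum_prod_norm_proj_proj_rootVec_sq B hρ).summable h1
    (hρ.summable_inner_map _).hasSum

lemma hasSum_expect_apply (hρ : IsState ρ) (f : C₀(B.spec, ℂ)) :
    HasSum (fun p : A.spec × B.spec => f p.2 * (B.opProb A ρ p.swap : ℂ))
      (expect ρ (B.apply f)) := by
  have hc : ∀ p : A.spec × B.spec, ‖f p.2‖ ≤ ‖B.apply f‖ :=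
    fun p => B.norm_coe_le_norm_apply f p.2
  have h0 : ∀ q : basisSet H × A.spec × B.spec,
      0 ≤ ‖A.proj q.2.1 (B.proj q.2.2 (rootVec ρ q.1))‖ ^ 2 := fun q => sq_nonneg _
  have hs : Summable fun q : basisSet H × A.spec × B.spec =>
      ‖A.proj q.2.1 (B.proj q.2.2 (rootVec ρ q.1))‖ ^ 2 :=
    ((Equiv.refl _).prodCongr (Equiv.prodComm A.spec B.spec)).summable_iff.2
      (B.hasSum_prod_norm_proj_proj_rootVec_sq A hρ).summable
  have h1 : ∀ j, HasSum (fun p : A.spec × B.spec =>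
        f p.2 * ((‖A.proj p.1 (B.proj p.2 (rootVec ρ j))‖ ^ 2 : ℝ) : ℂ))
      ⟪rootVec ρ j, B.apply f (rootVec ρ j)⟫_ℂ :=
    fun j => A.hasSum_inner_apply_swap B f (rootVec ρ j)
  simp only [B.opProb_eq A hρ, hρ.expect_eq]
  exact hasSum_mul_tsum_ofReal hc h0 hs h1 (hρ.summable_inner_map _).hasSum

lemma maxDisturbance_le_tsum (hρ : IsState ρ) :
    A.maxDisturbance B ρ ≤ ∑' p : A.spec × B.spec, ‖A.opProb B ρ p - B.opProb A ρ p.swap‖ₑ := by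
  -- This also covers a zero denominator: the product bound then forces the numerator to vanish, and
  -- `0 / 0 = 0`.
  refine iSup_le fun f => ENNReal.div_le_of_le_mul ?_
  have h := (A.hasSum_expect_channelDual_apply B hρ f).sub (A.hasSum_expect_apply B hρ f)
  rw [disturbance, hρ.expect_sub, ← h.tsum_eq]
  refine (enorm_tsum_le_tsum_enorm).trans ?_
  rw [← ENNReal.tsum_mul_right]
  refine ENNReal.tsum_le_tsum fun p => ?_
  rw [← mul_sub, ← Complex.ofReal_sub, enorm_mul, mul_comm]
  gcongr
  · exact (enorm_eq_iff_norm_eq.2 (Complex.norm_real _)).le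
  · exact enorm_le_iff_norm_le.2 (B.norm_coe_le_norm_apply f p.2)

end Observable

/-! ### The joint distributions as signed measures -/

lemma tsum_enorm_singleton_le_totalVariation {α : Type*} [MeasurableSpace α]
    [MeasurableSingletonClass α] (s : MeasureTheory.SignedMeasure α) :
    ∑' x, ‖s {x}‖ₑ ≤ s.totalVariation Set.univ := by
  have h : ∀ x, ‖s {x}‖ₑ ≤ s.totalVariation {x} := fun x => by
    rw [s.apply_eq_posPart_real_sub_negPart_real (measurableSet_singleton x),
      MeasureTheory.SignedMeasure.totalVariation, MeasureTheory.Measure.add_apply]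
    refine enorm_sub_le.trans_eq ?_
    simp [Real.enorm_eq_ofReal]
  exact (ENNReal.tsum_le_tsum h).trans
    (MeasureTheory.tsum_meas_le_meas_iUnion_of_disjoint _ measurableSet_singleton
      (fun x y hxy => by simpa using hxy) |>.trans (MeasureTheory.measure_mono (Set.subset_univ _)))

lemma withDensityᵥ_count_singleton {α : Type*} [MeasurableSpace α] [MeasurableSingletonClass α]
    {f : α → ℝ} (hf : Summable f) (x : α) :
    (MeasureTheory.Measure.count : MeasureTheory.Measure α).withDensityᵥ f {x} = f x := by
  -- A summable function has countable support, so measurable singletons suffice. Integrability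
  -- matters because `withDensityᵥ` is `0` for a non-integrable density.
  have hm : Measurable f := (measurable_const (a := (0 : ℝ))).measurable_of_countable_ne
    (hf.countable_support.mono fun y hy => fun h => hy h.symm)
  have hi : MeasureTheory.Integrable f MeasureTheory.Measure.count :=
    ⟨hm.aestronglyMeasurable, MeasureTheory.hasFiniteIntegral_count_iff.2 hf.norm⟩
  rw [MeasureTheory.withDensityᵥ_apply hi (measurableSet_singleton x)]
  simp

namespace Observable

variable (A B : Observable H) {ρ : H →L[ℂ] H}

lemma opDist_sub_apply_singleton (hρ : IsState ρ) (p : A.spec × B.spec) :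
    (A.opDist B ρ - (B.opDist A ρ).map Prod.swap) {p}
      = A.opProb B ρ p - B.opProb A ρ p.swap := by
  have h : (Prod.swap ⁻¹' {p} : Set (B.spec × A.spec)) = {p.swap} := by
    ext q
    simp [Prod.ext_iff, and_comm]
  rw [sub_apply,
    MeasureTheory.VectorMeasure.map_apply _ measurable_swap (measurableSet_singleton p), h,
    opDist, opDist, withDensityᵥ_count_singleton (A.hasSum_opProb B hρ).summable,
    withDensityᵥ_count_singleton (B.hasSum_opProb A hρ).summable]

lemma tsum_enorm_opProb_sub_comm (ρ : H →L[ℂ] H) :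
    ∑' p : B.spec × A.spec, ‖B.opProb A ρ p - A.opProb B ρ p.swap‖ₑ
      = ∑' p : A.spec × B.spec, ‖A.opProb B ρ p - B.opProb A ρ p.swap‖ₑ := by
  rw [← (Equiv.prodComm A.spec B.spec).tsum_eq]
  simp [enorm_sub_rev]

end Observable

end SeqMeas

theorem mainTheorem4 {H : Type*} [NormedAddCommGroup H] [InnerProductSpace ℂ H] [CompleteSpace H]
    (A B : SeqMeas.Observable H) (ρ : H →L[ℂ] H) (hρ : SeqMeas.IsState ρ) :
    ((∀ p, 0 ≤ A.opProb B ρ p) ∧ HasSum (A.opProb B ρ) 1) ∧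
    ((∀ p, 0 ≤ B.opProb A ρ p) ∧ HasSum (B.opProb A ρ) 1) ∧
    max (A.maxDisturbance B ρ) (B.maxDisturbance A ρ) ≤
      (A.opDist B ρ - (B.opDist A ρ).map Prod.swap).totalVariation Set.univ := by
  refine ⟨⟨A.opProb_nonneg B hρ, A.hasSum_opProb B hρ⟩,
    ⟨B.opProb_nonneg A hρ, B.hasSum_opProb A hρ⟩, ?_⟩
  have h := SeqMeas.tsum_enorm_singleton_le_totalVariation
    (A.opDist B ρ - (B.opDist A ρ).map Prod.swap)
  simp only [A.opDist_sub_apply_singleton B hρ] at h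
  refine (max_le (A.maxDisturbance_le_tsum B hρ) ?_).trans h
  exact (B.maxDisturbance_le_tsum A hρ).trans_eq (A.tsum_enorm_opProb_sub_comm B ρ)
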